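/- **Setting.** Let $d,k\ge 1$, let $w_{\mathrm{low}}>0$, $\varepsilon>0$ and $w_1,\dots,w_k\ge w_{\mathrm{low}}$ with $\sum_{i=1}^k w_i+\varepsilon=1$. Consider corrupted mixtures $\mathcal X=\sum_{i=1}^k w_iD_i(\mu_i)+\varepsilon Q$ on $\mathbb R^d$, where $D_i(\mu_i)$ is a probability distribution with mean $\mu_i$ and $Q$ is an arbitrary probability distribution, and put $\tilde w_i=\dfrac{w_i}{w_i+\varepsilon+w_{\mathrm{low}}^2}$. For even $t\ge 2$, a distribution $D$ with mean $\mu$ has *sub-Gaussian $t$-th central moments* if $\mathbb E_{x\sim D}\langle x-\mu,v\rangle^r\le (r-1)!!$ for all even $r\le t$ and all unit vectors $v$. A (possibly randomized) algorithm $\mathcal A$ receives i.i.d. samples from $\mathcal X$, as many as it wants, and outputs a finite list $L\subset\mathbb R^d$. Given a class of such mixtures (with the fixed weights $w_i,\varepsilon$), we say that $\mathcal A$ has error bounds $\beta_1,\dots,\beta_k$ and list size $\ell$ on it if for every mixture in the class, with probability at least $1/2$, $|L|\le\ell$ and for each $i\in[k]$ there is $\hat\mu\in L$ with $\|\hat\mu-\mu_i\|\le\beta_i$.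 Let $K,C>0$ be arbitrary constants and suppose that $w_s\le\varepsilon$ for some $s\in[k]$. **(a)** There is a universal constant $c>0$ such that for every even $t\ge2$: if $\mathcal A$ has error bounds $\beta_i\le C(1/w_{\mathrm{low}})^{1/t}$ and list size $\ell$ on the class of mixtures whose $D_i(\mu_i)$ have sub-Gaussian $t$-th central moments and whose means satisfy $\|\mu_i-\mu_j\|\ge K(1/w_{\mathrm{low}})^{4/t}$ for $i\ne j$, then $$\beta_s\ge c\,(1/\tilde w_s)^{1/t}\qquad\text{or}\qquad \ell\ge k+d-1 .$$ **(b)** There is a universal constant $a>0$ such that for every $p>0$ there is a constant $c=c(p)>0$ with the following property: if $\mathcal A$ has error bounds $\beta_i\le C\sqrt{\log(1/w_{\mathrm{low}})}$ and list size $\ell$ on the class of mixtures with $D_i(\mu_i)=\mathcal N(\mu_i,I_d)$ and $\|\mu_i-\mu_j\|\ge K\sqrt{\log(1/w_{\mathrm{low}})}$ for $i\ne j$, then $$\beta_s\ge c\,\sqrt{\log(1/\tilde w_s)}\qquad\text{or}\qquad \ell\ge k+\min\{2^{ad},(1/\tilde w_s)^{p}\}.$$ The constants $c$ and $a$ do not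 depend on $d,k,w,\varepsilon,w_{\mathrm{low}},s,\mathcal A,\beta,\ell,K,C$. -/

import Mathlib

open MeasureTheory ProbabilityTheory
open scoped Nat RealInnerProductSpace

noncomputable section

/-- The ambient space `ℝ^d` with its Euclidean norm. -/
abbrev Rd (d : ℕ) : Type := EuclideanSpace ℝ (Fin d)

/-- A finite list of points of `ℝ^d`: its length `L.1` together with its entries `L.2`. -/
abbrev HypothesisList (d : ℕ) : Type := Σ m : ℕ, (Fin m → Rd d)

/-- `D` is a distribution on `ℝ^d` with mean `μ` and sub-Gaussian `t`-th central moments. -/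
structure HasSubGaussianMoments {d : ℕ} (t : ℕ) (μ : Rd d) (D : Measure (Rd d)) : Prop where
  prob : IsProbabilityMeasure D
  integrable : Integrable (fun x => x) D
  mean : ∫ x, x ∂D = μ
  integrable_pow : ∀ s : ℕ, Even s → s ≤ t → ∀ v : Rd d, ‖v‖ = 1 →
    Integrable (fun x => ⟪x - μ, v⟫ ^ s) D
  moment_le : ∀ s : ℕ, Even s → s ≤ t → ∀ v : Rd d, ‖v‖ = 1 →
    ∫ x, ⟪x - μ, v⟫ ^ s ∂D ≤ (((s - 1)‼ : ℕ) : ℝ)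

/-- `D` is the spherical Gaussian `N(μ, I_d)`. -/
def IsSphericalGaussian {d : ℕ} (μ : Rd d) (D : Measure (Rd d)) : Prop :=
  D = multivariateGaussian μ 1

/-- Mixing proportions of `k` inlier components and of the outliers, where `wlow` is a valid
positive lower bound on the inlier weights. -/
structure IsMixingWeights {k : ℕ} (w : Fin k → ℝ) (ε wlow : ℝ) : Prop where
  wlow_pos : 0 < wlow
  wlow_le : ∀ i, wlow ≤ w i
  eps_pos : 0 < ε
  sum_eq_one : ∑ i, w i + ε = 1

/-- The corrupted mixture `∑ i, w i • D i + ε • Q`. -/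
def corruptedMixture {d k : ℕ} (w : Fin k → ℝ) (ε : ℝ) (D : Fin k → Measure (Rd d))
    (Q : Measure (Rd d)) : Measure (Rd d) :=
  ∑ i, ENNReal.ofReal (w i) • D i + ENNReal.ofReal ε • Q

/-- Admissible data of a mixture: every inlier component `D i` lies in the family `F` (read
`F μ D` as "`D` belongs to the inlier class and has mean `μ`"), the means have pairwise distance
at least `Δ`, and the outlier distribution `Q` is an arbitrary probability measure. -/
structure IsSeparatedInstance {d k : ℕ} (F : Rd d → Measure (Rd d) → Prop) (Δ : ℝ)
    (μ : Fin k → Rd d) (D : Fin k → Measure (Rd d)) (Q : Measure (Rd d)) : Prop where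
  component : ∀ i, F (μ i) (D i)
  separated : ∀ i j, i ≠ j → Δ ≤ ‖μ i - μ j‖
  outlier_prob : IsProbabilityMeasure Q

/-- The law of the list returned by the (possibly randomized) algorithm `A` when it reads an
i.i.d. sequence of samples from `X`. An algorithm that draws `n` samples is one that only looks at
the first `n` terms of the sequence. -/
def outputLaw {d : ℕ} (A : Kernel (ℕ → Rd d) (HypothesisList d)) (X : Measure (Rd d)) :
    Measure (HypothesisList d) :=
  (Measure.infinitePi (fun _ : ℕ => X)).bind A

/-- `A` solves list-decodable mixture learning with error bounds `β` and list size at most `ℓ`,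
for inlier class `F`, separation `Δ` and mixing proportions `w`, `ε`: on each such mixture, with
probability at least `1/2`, the list has at most `ℓ` entries and, for every component `i`,
contains an entry at distance at most `β i` from the mean of that component. -/
def SolvesMixtureLearning {d k : ℕ} (A : Kernel (ℕ → Rd d) (HypothesisList d))
    (F : Rd d → Measure (Rd d) → Prop) (Δ : ℝ) (w : Fin k → ℝ) (ε : ℝ) (β : Fin k → ℝ)
    (ℓ : ℕ) : Prop :=
  ∀ (μ : Fin k → Rd d) (D : Fin k → Measure (Rd d)) (Q : Measure (Rd d)),
    IsSeparatedInstance F Δ μ D Q →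
    (1 / 2 : ENNReal) ≤ outputLaw A (corruptedMixture w ε D Q)
      {L | L.1 ≤ ℓ ∧ ∀ i, ∃ j, ‖L.2 j - μ i‖ ≤ β i}

/-- The relative proportion of a component of weight `wi`. -/
def relWeight (wi ε wlow : ℝ) : ℝ := wi / (wi + ε + wlow ^ 2)

end

/-! Outliers can hide the mean of component `s`. Take candidate means `ν j` with laws `P j` and one
probability measure `R` such that `w s • P j ≤ (w s + ε) • R` for all `j`. The outlier law
proportional to `(w s + ε) • R - w s • P j` then makes the whole mixture independent of `j`, so the
list has the same law for every `j`, and by averaging a single list succeeds for at least half of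
the candidates. The other means are placed very far away and use up `k - 1` entries; if a ball of
radius `β s` holds at most `B` candidates, at least `card ι / (2 * B)` further entries are needed.
This is `exists_card_le_of_solves`.

For (a) the candidates are the `2 * d` points `± r` on the axes and `R` is a product of three-point
laws on `{-r, 0, r}`; `P j` freezes one coordinate at an atom of mass `q = w s / (w s + ε)`. The
moment bounds allow `r` of order `(1 / q) ^ (1 / t)`.

For (b) the candidates form a grid with `256 ^ m` points, and `R` is a centred Gaussian with
slightly inflated variance in `m` coordinates. The density ratio costs `exp (256 * m * δ)` for
spacing `δ`, while a ball of radius of order `δ * √m` holds at most `32 ^ m` grid points. Taking `m`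
of order `log (1 / relWeight)`, capped by `d`, balances the two. -/

/-! ### Domination of product measures -/

/-- It suffices to compare on boxes, because the product measure comes from the largest outer
measure bounded by the box values. -/
theorem pi_le_smul_pi {ι : Type*} [Fintype ι] {α : ι → Type*} [∀ i, MeasurableSpace (α i)]
    {ν ρ : ∀ i, Measure (α i)} [∀ i, IsFiniteMeasure (ν i)] [∀ i, IsFiniteMeasure (ρ i)]
    (c : ι → NNReal) (h : ∀ i, ν i ≤ c i • ρ i) :
    Measure.pi ν ≤ (∏ i, c i) • Measure.pi ρ := by
  have key : (Measure.pi ν).toOuterMeasure ≤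
      OuterMeasure.pi fun i => (c i • ρ i).toOuterMeasure := by
    rw [OuterMeasure.le_pi]
    intro s _
    rw [Measure.coe_toOuterMeasure, Measure.pi_pi]
    exact Finset.prod_le_prod' fun i _ => h i (s i)
  have h2 : (Measure.pi fun i => c i • ρ i) = (∏ i, c i) • Measure.pi ρ := by
    refine (Measure.pi_eq fun s hs => ?_)
    rw [Measure.smul_apply, Measure.pi_pi, ENNReal.smul_def, ENNReal.ofNNReal_finsetProd, smul_eq_mul,
      ← Finset.prod_mul_distrib]
    rfl
  rw [← h2]
  refine Measure.le_iff.2 fun s hs => ?_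
  rw [Measure.pi_def fun i => c i • ρ i, toMeasure_apply _ _ hs]
  exact key s

/-! ### Indistinguishable mixtures and the list-size count -/

/-- If events have probability at least one half each, some point lies in at least half of them. -/
theorem exists_card_le_two_mul_card_filter {Ω ι : Type*} [MeasurableSpace Ω] [Fintype ι]
    [Nonempty ι]
    (P : Measure Ω) (hP : P Set.univ ≤ 1) (E : ι → Set Ω) (hE : ∀ j, MeasurableSet (E j))
    (h : ∀ j, 1 / 2 ≤ P (E j)) :
    ∃ (x : Ω) (J : Finset ι), (∀ j ∈ J, x ∈ E j) ∧ Fintype.card ι ≤ 2 * J.card := by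
  classical
  by_contra! hcon
  -- With integer counts, fewer than half means at most `(N - 1) / 2`, so integrating a weak
  -- inequality already contradicts the total `N / 2`.
  have h1 : ∀ x, ∑ j, (E j).indicator (fun _ => (1 : ENNReal)) x
      ≤ ((Fintype.card ι - 1 : ℕ) : ENNReal) / 2 := fun x => by
    have h2 := hcon x (Finset.univ.filter fun j => x ∈ E j) (by simp)
    simp only [Set.indicator_apply, Finset.sum_boole]
    rw [ENNReal.le_div_iff_mul_le (by simp) (by simp)]
    exact_mod_cast (by omega)
  have h3 : (Fintype.card ι : ENNReal) * (1 / 2) ≤ ((Fintype.card ι - 1 : ℕ) : ENNReal) / 2 := by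
    calc (Fintype.card ι : ENNReal) * (1 / 2) = ∑ j : ι, (1 / 2 : ENNReal) := by simp
      _ ≤ ∑ j, P (E j) := Finset.sum_le_sum fun j _ => h j
      _ = ∫⁻ x, ∑ j, (E j).indicator (fun _ => (1 : ENNReal)) x ∂P := by
        rw [lintegral_finsetSum _ fun j _ => measurable_const.indicator (hE j)]
        exact Finset.sum_congr rfl fun j _ => by
          rw [lintegral_indicator (hE j)]; simp
      _ ≤ ∫⁻ x, ((Fintype.card ι - 1 : ℕ) : ENNReal) / 2 ∂P := lintegral_mono h1
      _ ≤ _ := by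
        rw [lintegral_const]
        exact mul_le_of_le_one_right' hP
  rw [mul_one_div, ENNReal.le_div_iff_mul_le (by simp) (by simp),
    ENNReal.div_mul_cancel (by simp) (by simp)] at h3
  have := Fintype.card_pos (α := ι)
  norm_cast at h3
  omega

theorem outputLaw_univ_le_one {d : ℕ} (A : Kernel (ℕ → Rd d) (HypothesisList d)) [IsMarkovKernel A]
    (X : Measure (Rd d)) [IsProbabilityMeasure X] : outputLaw A X Set.univ ≤ 1 := by
  have : IsProbabilityMeasure (outputLaw A X) := by unfold outputLaw; infer_instance
  exact prob_le_one

theorem measurableSet_covering {d k : ℕ} (ℓ : ℕ) (μ : Fin k → Rd d) (β : Fin k → ℝ) :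
    MeasurableSet {L : HypothesisList d | L.1 ≤ ℓ ∧ ∀ i, ∃ j, ‖L.2 j - μ i‖ ≤ β i} := by
  refine MeasurableSpace.measurableSet_iInf.2 fun m => ?_
  change MeasurableSet {L : Fin m → Rd d | m ≤ ℓ ∧ ∀ i, ∃ j, ‖L j - μ i‖ ≤ β i}
  suffices h : MeasurableSet {L : Fin m → Rd d | ∀ i, ∃ j, ‖L j - μ i‖ ≤ β i} from
    (MeasurableSet.const _).inter h
  have : {L : Fin m → Rd d | ∀ i, ∃ j, ‖L j - μ i‖ ≤ β i}
      = ⋂ i, ⋃ j, {L : Fin m → Rd d | ‖L j - μ i‖ ≤ β i} := by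
    ext L
    simp
  rw [this]
  exact MeasurableSet.iInter fun i => MeasurableSet.iUnion fun j =>
    measurableSet_le (by fun_prop) measurable_const

/-- There are arbitrarily widely separated families of `k` points, far away from the origin. -/
theorem exists_far_means {d k : ℕ} (hd : 1 ≤ d) (T : ℝ) (hT : 0 ≤ T) :
    ∃ x : Fin k → Rd d, (∀ i, T ≤ ‖x i‖) ∧ ∀ i j, i ≠ j → T ≤ ‖x i - x j‖ := by
  refine ⟨fun i => EuclideanSpace.single ⟨0, hd⟩ (T * (i + 1)), fun i => ?_, fun i j hij => ?_⟩
  · rw [PiLp.norm_single, Real.norm_eq_abs]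
    refine le_trans ?_ (le_abs_self _)
    nlinarith [(Nat.cast_nonneg (i : ℕ) : (0 : ℝ) ≤ i)]
  · rw [← PiLp.single_sub, PiLp.norm_single, Real.norm_eq_abs]
    have h1 : T * (i + 1) - T * (j + 1) = T * (((i : ℤ) - (j : ℤ) : ℤ) : ℝ) := by push_cast; ring
    rw [h1, abs_mul, abs_of_nonneg hT]
    refine le_mul_of_one_le_right hT ?_
    rw [← Int.cast_abs]
    have : (i : ℤ) - j ≠ 0 := by
      intro h; apply hij; ext; omega
    exact_mod_cast Int.one_le_abs this

/-- By the triangle inequality the entries serving the `k - 1` fixed means are distinct and none of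
them serves a candidate. The number of entries that serve candidates is `n`, and each serves at most
`B`. -/
theorem card_le_mul_of_covering {d k m : ℕ} (L : Fin m → Rd d) (x : Fin k → Rd d) (s : Fin k)
    (β : Fin k → ℝ) {ι : Type*} [Fintype ι] [Nonempty ι] (ν : ι → Rd d) (J : Finset ι) (hJ : J.Nonempty)
    (hcov : ∀ j ∈ J, ∀ i, ∃ l, ‖L l - (if i = s then ν j else x i)‖ ≤ β i)
    (hx : ∀ i i', i ≠ i' → β i + β i' < ‖x i - x i'‖)
    (hxν : ∀ i j, β i + β s < ‖x i - ν j‖)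
    (B : ℕ) (hB : ∀ y, {j | ‖y - ν j‖ ≤ β s}.ncard ≤ B) :
    ∃ n : ℕ, n + k ≤ m + 1 ∧ J.card ≤ B * n := by
  classical
  have tri : ∀ {y u v : Rd d} {a b : ℝ}, ‖y - u‖ ≤ a → ‖y - v‖ ≤ b → ‖u - v‖ ≤ a + b := by
    intro y u v a b h1 h2
    rw [norm_sub_rev] at h1
    calc ‖u - v‖ = ‖(u - y) + (y - v)‖ := by simp
      _ ≤ _ := (norm_add_le _ _).trans (add_le_add h1 h2)
  obtain ⟨j₀, hj₀⟩ := hJ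
  have hf : ∀ i : {i : Fin k // i ≠ s}, ∃ l, ‖L l - x i‖ ≤ β i := fun i => by
    simpa [i.2] using hcov j₀ hj₀ i
  choose f hf using hf
  have hg : ∀ j : J, ∃ l, ‖L l - ν j‖ ≤ β s := fun j => by
    simpa using hcov j j.2 s
  choose g hg using hg
  have finj : Function.Injective f := fun i i' h => by
    by_contra hne
    have h1 := hf i'
    rw [← h] at h1
    exact absurd (tri (hf i) h1) (not_le.2 (hx _ _ fun h => hne (Subtype.ext h)))
  set I : Finset (Fin m) := Finset.univ.image g
  have hdisj : Disjoint (Finset.univ.image f) I := by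
    rw [Finset.disjoint_left]
    rintro l h1 h2
    obtain ⟨i, -, rfl⟩ := Finset.mem_image.1 h1
    obtain ⟨j, -, h3⟩ := Finset.mem_image.1 h2
    have h4 := hg j
    rw [h3] at h4
    exact absurd (tri (hf i) h4) (not_le.2 (hxν _ _))
  refine ⟨I.card, ?_, ?_⟩
  · have h1 := Finset.card_le_univ (Finset.univ.image f ∪ I)
    rw [Finset.card_union_of_disjoint hdisj, Finset.card_image_of_injective _ finj,
      Finset.card_univ, Fintype.card_subtype_compl, Fintype.card_fin, Fintype.card_fin] at h1
    simp at h1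
    omega
  · rw [← Fintype.card_coe J, ← Finset.card_univ]
    refine Finset.card_le_mul_card_image _ _ fun l _ => ?_
    rw [← Finset.card_map (Function.Embedding.subtype _), ← Set.ncard_coe_finset]
    refine (Set.ncard_le_ncard ?_ (Set.toFinite _)).trans (hB (L l))
    intro j hj
    simp only [Finset.coe_map, Set.mem_image, Finset.mem_coe, Finset.mem_filter] at hj
    obtain ⟨j', ⟨-, rfl⟩, rfl⟩ := hj
    exact hg j'

/-- The reduction common to both bounds: what remains is to find many candidates dominated by one
`R` and rarely sharing a ball. -/
theorem exists_card_le_of_solves {d k : ℕ} (hd : 1 ≤ d) {F : Rd d → Measure (Rd d) → Prop}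
    {Δ : ℝ} {w : Fin k → ℝ} {ε wlow : ℝ} (hw : IsMixingWeights w ε wlow) (s : Fin k)
    {A : Kernel (ℕ → Rd d) (HypothesisList d)} [IsMarkovKernel A] {β : Fin k → ℝ} {ℓ : ℕ}
    (hA : SolvesMixtureLearning A F Δ w ε β ℓ)
    (hF : ∀ x, ∃ D, IsProbabilityMeasure D ∧ F x D)
    {ι : Type*} [Fintype ι] [Nonempty ι] (ν : ι → Rd d) (P : ι → Measure (Rd d))
    [∀ j, IsProbabilityMeasure (P j)] (hP : ∀ j, F (ν j) (P j))
    (R : Measure (Rd d)) [IsProbabilityMeasure R]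
    (hle : ∀ j, ENNReal.ofReal (w s) • P j ≤ ENNReal.ofReal (w s + ε) • R)
    (B : ℕ) (hB : ∀ y, {j | ‖y - ν j‖ ≤ β s}.ncard ≤ B) :
    ∃ n : ℕ, n + k ≤ ℓ + 1 ∧ Fintype.card ι ≤ 2 * (B * n) := by
  classical
  have hws : 0 < w s := hw.wlow_pos.trans_le (hw.wlow_le s)
  have hε := hw.eps_pos
  -- Means at this scale are `Δ`-separated from each other and from all candidates, and the final
  -- `1` makes the `β`-balls strictly disjoint.
  set T : ℝ := ∑ j, ‖ν j‖ + |Δ| + 2 * ∑ i, |β i| + 1 with hT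
  have hΔ := abs_nonneg Δ
  have hβ0 : 0 ≤ ∑ i, |β i| := Finset.sum_nonneg fun i _ => abs_nonneg _
  have hν0 : 0 ≤ ∑ j, ‖ν j‖ := Finset.sum_nonneg fun i _ => norm_nonneg _
  have hβ : ∀ i, β i ≤ ∑ i, |β i| := fun i => (le_abs_self _).trans
    (Finset.single_le_sum (f := fun i => |β i|) (fun i _ => abs_nonneg _) (Finset.mem_univ i))
  have hν : ∀ j, ‖ν j‖ ≤ ∑ j, ‖ν j‖ := fun j =>
    Finset.single_le_sum (f := fun i => ‖ν i‖) (fun i _ => norm_nonneg _) (Finset.mem_univ j)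
  obtain ⟨x, hx1, hx2⟩ := exists_far_means (k := k) hd T (by positivity)
  choose D hDp hD using hF
  have hxν : ∀ i j, T - ∑ j, ‖ν j‖ ≤ ‖x i - ν j‖ := fun i j => by
    linarith [hx1 i, hν j, norm_sub_norm_le (x i) (ν j)]
  let m : ι → Fin k → Rd d := fun j i => if i = s then ν j else x i
  let Dm : ι → Fin k → Measure (Rd d) := fun j i => if i = s then P j else D (x i)
  -- The outliers supply exactly what `w s • P j` lacks to reach `(w s + ε) • R`; the total mass is
  -- `(w s + ε - w s) / ε = 1`.
  let Q : ι → Measure (Rd d) := fun j =>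
    (ENNReal.ofReal ε)⁻¹ • (ENNReal.ofReal (w s + ε) • R - ENNReal.ofReal (w s) • P j)
  let X : Measure (Rd d) := ∑ i ∈ Finset.univ.erase s, ENNReal.ofReal (w i) • D (x i)
    + ENNReal.ofReal (w s + ε) • R
  have hεne : ENNReal.ofReal ε ≠ 0 := by simpa using hε
  have hfin : ∀ j, IsFiniteMeasure (ENNReal.ofReal (w s) • P j) := fun j =>
    Measure.smul_finite _ ENNReal.ofReal_ne_top
  have hXeq : ∀ j, corruptedMixture w ε (Dm j) (Q j) = X := fun j => by
    have h1 : ENNReal.ofReal ε • Q j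
        = ENNReal.ofReal (w s + ε) • R - ENNReal.ofReal (w s) • P j := by
      rw [smul_smul, ENNReal.mul_inv_cancel hεne ENNReal.ofReal_ne_top, one_smul]
    have h2 := Measure.sub_add_cancel_of_le (hle j)
    rw [corruptedMixture, h1, ← Finset.sum_erase_add _ _ (Finset.mem_univ s), add_assoc]
    congr 1
    · refine Finset.sum_congr rfl fun i hi => ?_
      simp [Dm, Finset.ne_of_mem_erase hi]
    · simp only [Dm, if_true]
      rw [add_comm, h2]
  have hXp : IsProbabilityMeasure X := by
    constructor
    have h0 : ∀ i, 0 ≤ w i := fun i => (hw.wlow_pos.trans_le (hw.wlow_le i)).le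
    have h1 : ∑ i ∈ Finset.univ.erase s, w i + w s = ∑ i, w i :=
      Finset.sum_erase_add _ _ (Finset.mem_univ s)
    simp only [X, Measure.add_apply, Measure.finsetSum_apply, Measure.smul_apply, measure_univ,
      smul_eq_mul, mul_one]
    rw [← ENNReal.ofReal_sum_of_nonneg fun i _ => h0 i, ← ENNReal.ofReal_add
      (Finset.sum_nonneg fun i _ => h0 i) (by positivity), ENNReal.ofReal_eq_one,
      ← hw.sum_eq_one, ← h1]
    ring
  have hQ : ∀ j, IsProbabilityMeasure (Q j) := fun j => by
    constructor
    simp only [Q, Measure.smul_apply, smul_eq_mul]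
    rw [Measure.sub_apply MeasurableSet.univ (hle j)]
    simp only [Measure.smul_apply, measure_univ, smul_eq_mul, mul_one]
    rw [← ENNReal.ofReal_sub _ hws.le, add_sub_cancel_left,
      ENNReal.inv_mul_cancel hεne ENNReal.ofReal_ne_top]
  have hsep : ∀ j, IsSeparatedInstance F Δ (m j) (Dm j) (Q j) := fun j => by
    refine ⟨fun i => ?_, fun i i' hii => ?_, hQ j⟩
    · by_cases h : i = s
      · simp [m, Dm, h, hP]
      · simp [m, Dm, h, hD]
    · have hle := le_abs_self Δ
      by_cases h : i = s <;> by_cases h' : i' = s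
      · exact absurd (h.trans h'.symm) hii
      · simp only [m, h, h', if_true, if_false]
        rw [norm_sub_rev]
        linarith [hxν i' j]
      · simp only [m, h, h', if_true, if_false]
        linarith [hxν i j]
      · simp only [m, h, h', if_false]
        linarith [hx2 i i' hii]
  obtain ⟨L, J, hLJ, hcard⟩ := exists_card_le_two_mul_card_filter (outputLaw A X)
    (outputLaw_univ_le_one A X)
    (fun j : ι => {L : HypothesisList d | L.1 ≤ ℓ ∧ ∀ i, ∃ l, ‖L.2 l - m j i‖ ≤ β i})
    (fun j => measurableSet_covering ℓ (m j) β)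
    (fun j => by have := hA (m j) (Dm j) (Q j) (hsep j); rwa [hXeq j] at this)
  have hJ : J.Nonempty := by
    have := Fintype.card_pos (α := ι)
    rw [← Finset.card_pos]; omega
  obtain ⟨n, hn, hJn⟩ := card_le_mul_of_covering L.2 x s β ν J hJ (fun j hj => (hLJ j hj).2)
    (fun i i' h => by linarith [hx2 i i' h, hβ i, hβ i'])
    (fun i j => by linarith [hxν i j, hβ i, hβ s]) B hB
  obtain ⟨j, hj⟩ := hJ
  have := (hLJ j hj).1
  exact ⟨n, by omega, by omega⟩

/-! ### Gaussian moment bounds for sums of independent variables -/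

theorem sum_range_even_add_odd (f : ℕ → ℝ) (n : ℕ) :
    ∑ j ∈ Finset.range (2 * n + 1), f j
      = ∑ a ∈ Finset.range (n + 1), f (2 * a) + ∑ a ∈ Finset.range n, f (2 * a + 1) := by
  induction n with
  | zero => simp
  | succ n ih =>
    rw [show 2 * (n + 1) + 1 = 2 * n + 1 + 1 + 1 by ring, Finset.sum_range_succ,
      Finset.sum_range_succ, ih, Finset.sum_range_succ _ (n + 1), Finset.sum_range_succ (fun a => f (2 * a + 1)) n,
      show 2 * n + 1 + 1 = 2 * (n + 1) by ring]
    ring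

theorem doubleFactorial_two_mul_sub_one_mul (n : ℕ) :
    (((2 * n - 1)‼ : ℕ) : ℝ) * (2 ^ n * (n ! : ℝ)) = ((2 * n)! : ℕ) := by
  cases n with
  | zero => simp
  | succ n =>
    rw [← show (((2 * (n + 1))‼ : ℕ) : ℝ) = 2 ^ (n + 1) * ((n + 1)! : ℝ) by
      rw [Nat.doubleFactorial_two_mul]; push_cast; rfl]
    have := Nat.factorial_eq_mul_doubleFactorial (2 * n + 1)
    rw [show 2 * (n + 1) - 1 = 2 * n + 1 by omega, show 2 * (n + 1) = 2 * n + 1 + 1 by ring, this]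
    push_cast
    ring

/-- This identity turns the even part of the expansion of `(X + Y) ^ (2 * n)` into `(2 * n - 1)‼ *
(v + v') ^ n`. -/
theorem choose_mul_doubleFactorial (a b : ℕ) :
    ((2 * (a + b)).choose (2 * a) : ℝ) * (((2 * a - 1)‼ : ℕ) * ((2 * b - 1)‼ : ℕ))
      = ((2 * (a + b) - 1)‼ : ℕ) * ((a + b).choose a : ℝ) := by
  have ha := doubleFactorial_two_mul_sub_one_mul a
  have hb := doubleFactorial_two_mul_sub_one_mul b
  have hab := doubleFactorial_two_mul_sub_one_mul (a + b)
  have fa : (a ! : ℝ) ≠ 0 := by positivity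
  have fb : (b ! : ℝ) ≠ 0 := by positivity
  have fab : ((a + b)! : ℝ) ≠ 0 := by positivity
  have fa2 : ((2 * a)! : ℝ) ≠ 0 := by positivity
  have fb2 : ((2 * b)! : ℝ) ≠ 0 := by positivity
  rw [mul_add, Nat.cast_add_choose, Nat.cast_add_choose, ← mul_add, ← hab]
  rw [← eq_div_iff (by positivity)] at ha hb
  rw [ha, hb]
  field_simp
  ring

/-- All odd moments of `X` vanish and its even moments of order at most `t` are bounded by those of
a centered Gaussian of variance `v`. -/
structure HasSymmGaussianMoments {Ω : Type*} [MeasurableSpace Ω] (t : ℕ) (v : ℝ) (X : Ω → ℝ)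
    (P : Measure Ω) : Prop where
  integrable_pow : ∀ n : ℕ, Integrable (fun ω => X ω ^ n) P
  odd : ∀ n : ℕ, Odd n → ∫ ω, X ω ^ n ∂P = 0
  even : ∀ n : ℕ, 2 * n ≤ t → ∫ ω, X ω ^ (2 * n) ∂P ≤ ((2 * n - 1)‼ : ℕ) * v ^ n

namespace HasSymmGaussianMoments

variable {Ω : Type*} [MeasurableSpace Ω] {t : ℕ} {v v' : ℝ} {X Y : Ω → ℝ} {P : Measure Ω}

theorem zero [IsProbabilityMeasure P] : HasSymmGaussianMoments t 0 (fun _ : Ω => 0) P where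
  integrable_pow n := integrable_const _
  odd n hn := by simp [hn.pos.ne']
  even n _ := by
    rcases Nat.eq_zero_or_pos n with rfl | hn
    · simp
    · simp [hn.ne']

theorem const_mul (h : HasSymmGaussianMoments t v X P) (c : ℝ) :
    HasSymmGaussianMoments t (c ^ 2 * v) (fun ω => c * X ω) P where
  integrable_pow n := by
    simp only [mul_pow]
    exact (h.integrable_pow n).const_mul _
  odd n hn := by
    simp only [mul_pow, integral_const_mul, h.odd n hn, mul_zero]
  even n hn := by
    simp only [mul_pow, integral_const_mul]
    have := mul_le_mul_of_nonneg_left (h.even n hn) ((even_two_mul n).pow_nonneg c)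
    rw [← pow_mul]
    linarith

theorem add (h : HasSymmGaussianMoments t v X P) (h' : HasSymmGaussianMoments t v' Y P)
    (hv : 0 ≤ v) (hind : IndepFun X Y P) :
    HasSymmGaussianMoments t (v + v') (fun ω => X ω + Y ω) P := by
  have hindp : ∀ a b : ℕ, IndepFun (fun ω => X ω ^ a) (fun ω => Y ω ^ b) P := fun a b =>
    hind.comp (measurable_id.pow_const a) (measurable_id.pow_const b)
  have hint : ∀ a b : ℕ, Integrable (fun ω => X ω ^ a * Y ω ^ b) P := fun a b =>
    (hindp a b).integrable_mul (h.integrable_pow a) (h'.integrable_pow b)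
  have hmul : ∀ a b : ℕ, ∫ ω, X ω ^ a * Y ω ^ b ∂P = (∫ ω, X ω ^ a ∂P) * ∫ ω, Y ω ^ b ∂P :=
    fun a b => (hindp a b).integral_fun_mul_eq_mul_integral
      (h.integrable_pow a).aestronglyMeasurable (h'.integrable_pow b).aestronglyMeasurable
  have hexp : ∀ n : ℕ, ∫ ω, (X ω + Y ω) ^ n ∂P = ∑ j ∈ Finset.range (n + 1),
      (∫ ω, X ω ^ j ∂P) * (∫ ω, Y ω ^ (n - j) ∂P) * n.choose j := fun n => by
    simp only [add_pow]
    rw [integral_finsetSum _ fun j _ => (hint _ _).mul_const _]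
    exact Finset.sum_congr rfl fun j _ => by rw [integral_mul_const, hmul]
  refine ⟨fun n => ?_, fun n hn => ?_, fun n hn => ?_⟩
  · simp only [add_pow]
    exact integrable_finsetSum _ fun j _ => (hint _ _).mul_const _
  · rw [hexp]
    -- For odd `n`, one of `j` and `n - j` is odd.
    refine Finset.sum_eq_zero fun j hj => ?_
    rw [Finset.mem_range] at hj
    rcases Nat.even_or_odd j with hj' | hj'
    · rw [h'.odd (n - j) (Nat.Odd.sub_even (by omega) hn hj')]; simp
    · rw [h.odd j hj']; simp
  · rw [hexp, sum_range_even_add_odd, Finset.sum_eq_zero (s := Finset.range n), add_zero]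
    · rw [add_pow, Finset.mul_sum]
      refine Finset.sum_le_sum fun a ha => ?_
      rw [Finset.mem_range] at ha
      obtain ⟨b, rfl⟩ := Nat.exists_eq_add_of_le (Nat.lt_succ_iff.1 ha)
      rw [show 2 * (a + b) - 2 * a = 2 * b by omega, Nat.add_sub_cancel_left]
      have e1 := h.even a (by omega)
      have e2 := h'.even b (by omega)
      have p2 : 0 ≤ ∫ ω, Y ω ^ (2 * b) ∂P :=
        integral_nonneg fun ω => (even_two_mul b).pow_nonneg _
      have := mul_le_mul_of_nonneg_right (mul_le_mul e1 e2 p2 (by positivity))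
        (Nat.cast_nonneg (α := ℝ) ((2 * (a + b)).choose (2 * a)))
      refine this.trans (le_of_eq ?_)
      linear_combination (v ^ a * v' ^ b) * choose_mul_doubleFactorial a b
    · intro a ha
      rw [h.odd (2 * a + 1) (odd_two_mul_add_one a)]
      simp

theorem finset_sum [IsProbabilityMeasure P] {ι : Type*} {X : ι → Ω → ℝ} {v : ι → ℝ}
    (h : ∀ i, HasSymmGaussianMoments t (v i) (X i) P) (hv : ∀ i, 0 ≤ v i)
    (hX : ∀ i, AEMeasurable (X i) P) (hind : iIndepFun X P) (s : Finset ι) :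
    HasSymmGaussianMoments t (∑ i ∈ s, v i) (fun ω => ∑ i ∈ s, X i ω) P := by
  classical
  induction s using Finset.induction_on with
  | empty => simpa using zero
  | insert i s hi ih =>
    simp only [Finset.sum_insert hi]
    refine (h i).add ih (hv i) ?_
    have := (hind.indepFun_finsetSum_of_notMem₀ hX hi).symm
    convert this using 1
    ext ω
    simp

end HasSymmGaussianMoments

/-- In direction `v` the centred projection is a sum of independent terms with variance proxies `v i
^ 2`, which add up to `‖v‖ ^ 2 = 1`. -/
theorem hasSubGaussianMoments_map_pi {d t : ℕ} (κ : Fin d → Measure ℝ)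
    [∀ i, IsProbabilityMeasure (κ i)] (m : Fin d → ℝ)
    (h : ∀ i, HasSymmGaussianMoments t 1 (fun x => x - m i) (κ i)) :
    HasSubGaussianMoments t (WithLp.toLp 2 m)
      ((Measure.pi κ).map (WithLp.toLp 2 : (Fin d → ℝ) → Rd d)) := by
  have hmeas : Measurable (WithLp.toLp 2 : (Fin d → ℝ) → Rd d) := by fun_prop
  have hcoord : ∀ i, HasSymmGaussianMoments t 1 (fun x : Fin d → ℝ => x i - m i) (Measure.pi κ) := by
    intro i
    have hp := measurePreserving_eval κ i
    have e : ∀ n : ℕ, ∫ x : Fin d → ℝ, (x i - m i) ^ n ∂Measure.pi κ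
        = ∫ y, (y - m i) ^ n ∂κ i := fun n => by
      rw [← hp.map_eq, integral_map hp.measurable.aemeasurable (by fun_prop)]
    refine ⟨fun n => ?_, fun n hn => ?_, fun n hn => ?_⟩
    · exact hp.integrable_comp_of_integrable ((h i).integrable_pow n)
    · rw [e]; exact (h i).odd n hn
    · rw [e]; exact (h i).even n hn
  have hind : ∀ v : Rd d, iIndepFun (fun i (x : Fin d → ℝ) => v i * (x i - m i)) (Measure.pi κ) :=
    fun v => iIndepFun_pi (X := fun i y => v i * (y - m i))
      (fun i => ((measurable_id.sub_const (m i)).const_mul (v i)).aemeasurable)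
  have hdir : ∀ v : Rd d, HasSymmGaussianMoments t (∑ i, v i ^ 2)
      (fun x : Fin d → ℝ => ⟪WithLp.toLp 2 x - WithLp.toLp 2 m, v⟫) (Measure.pi κ) := fun v => by
    have hm : ∀ i, AEMeasurable (fun x : Fin d → ℝ => v i * (x i - m i)) (Measure.pi κ) := fun i => by
      simpa using (((hcoord i).integrable_pow 1).const_mul (v i)).aemeasurable
    have := HasSymmGaussianMoments.finset_sum (fun i => (hcoord i).const_mul (v i))
      (fun i => by positivity)
      hm (hind v) Finset.univ
    simp only [mul_one] at this
    convert this using 2 with x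
    simp [PiLp.inner_apply, mul_comm]
  have hp : IsProbabilityMeasure ((Measure.pi κ).map (WithLp.toLp 2 : (Fin d → ℝ) → Rd d)) :=
    Measure.isProbabilityMeasure_map hmeas.aemeasurable
  have hxi : ∀ i, Integrable (fun x : Fin d → ℝ => x i) (Measure.pi κ) := fun i => by
    have := ((hcoord i).integrable_pow 1).add (integrable_const (m i))
    refine this.congr (Filter.Eventually.of_forall fun x => ?_)
    simp
  have hi0 : Integrable (fun x : Fin d → ℝ => (WithLp.toLp 2 x : Rd d)) (Measure.pi κ) :=
    Integrable.of_eval_piLp hxi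
  have hi : Integrable (fun x : Rd d => x)
      ((Measure.pi κ).map (WithLp.toLp 2 : (Fin d → ℝ) → Rd d)) :=
    (integrable_map_measure (by fun_prop) hmeas.aemeasurable).2 hi0
  have hnorm : ∀ v : Rd d, ‖v‖ = 1 → ∑ i, v i ^ 2 = 1 := fun v hv => by
    rw [← EuclideanSpace.real_norm_sq_eq, hv, one_pow]
  refine ⟨hp, hi, ?_, fun s _ _ v _ => ?_, fun s hs hst v hv => ?_⟩
  · rw [integral_map hmeas.aemeasurable (by fun_prop)]
    ext i
    rw [eval_integral_piLp hxi]
    have := (hcoord i).odd 1 odd_one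
    simp only [pow_one] at this
    rw [integral_sub (hxi i) (integrable_const _)] at this
    simpa [sub_eq_zero] using this
  · exact (integrable_map_measure (by fun_prop) hmeas.aemeasurable).2 ((hdir v).integrable_pow s)
  · rw [integral_map hmeas.aemeasurable (by fun_prop)]
    obtain ⟨n, rfl⟩ := even_iff_exists_two_mul.1 hs
    simpa [hnorm v hv] using (hdir v).even n hst

theorem ofReal_smul_map_le_ofReal_smul_map {α β : Type*} [MeasurableSpace α] [MeasurableSpace β]
    {f : α → β} (hf : Measurable f) {P R : Measure α} {a b c : ℝ} (h : P ≤ c.toNNReal • R)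
    (ha : 0 ≤ a) (habc : a * c ≤ b) :
    ENNReal.ofReal a • P.map f ≤ ENNReal.ofReal b • R.map f := by
  refine Measure.le_iff.2 fun s hs => ?_
  simp only [Measure.smul_apply, smul_eq_mul, Measure.map_apply hf hs]
  calc ENNReal.ofReal a * P (f ⁻¹' s)
      ≤ ENNReal.ofReal a * (ENNReal.ofReal c * R (f ⁻¹' s)) := by
        gcongr
        exact h _
    _ = ENNReal.ofReal (a * c) * R (f ⁻¹' s) := by rw [ENNReal.ofReal_mul ha, mul_assoc]
    _ ≤ _ := by gcongr

/-! ### Three-point laws -/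

/-- The law on `{-r, 0, r}` giving mass `q` to each of `-r` and `r`. -/
noncomputable def threePoint (q r : ℝ) : Measure ℝ :=
  ENNReal.ofReal q • Measure.dirac (-r) + ENNReal.ofReal q • Measure.dirac r
    + ENNReal.ofReal (1 - 2 * q) • Measure.dirac 0

section threePoint

variable {q r : ℝ}

theorem isProbabilityMeasure_threePoint (hq : 0 ≤ q) (hq' : 2 * q ≤ 1) :
    IsProbabilityMeasure (threePoint q r) := by
  constructor
  simp only [threePoint, Measure.add_apply, Measure.smul_apply, measure_univ, smul_eq_mul, mul_one]
  rw [← ENNReal.ofReal_add hq hq, ← ENNReal.ofReal_add (by positivity) (by linarith),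
    ENNReal.ofReal_eq_one]
  ring

theorem integrable_threePoint (f : ℝ → ℝ) : Integrable f (threePoint q r) := by
  have h : ∀ a b : ℝ, Integrable f (ENNReal.ofReal a • Measure.dirac b) := fun a b =>
    (integrable_dirac (by simp)).smul_measure ENNReal.ofReal_ne_top
  exact ((h _ _).add_measure (h _ _)).add_measure (h _ _)

theorem integral_threePoint (hq : 0 ≤ q) (hq' : 2 * q ≤ 1) (f : ℝ → ℝ) :
    ∫ x, f x ∂threePoint q r = q * f (-r) + q * f r + (1 - 2 * q) * f 0 := by
  have h : ∀ a b : ℝ, Integrable f (ENNReal.ofReal a • Measure.dirac b) := fun a b =>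
    (integrable_dirac (by simp)).smul_measure ENNReal.ofReal_ne_top
  rw [threePoint, integral_add_measure ((h _ _).add_measure (h _ _)) (h _ _),
    integral_add_measure (h _ _) (h _ _)]
  simp only [integral_smul_measure, integral_dirac, smul_eq_mul, ENNReal.toReal_ofReal hq,
    ENNReal.toReal_ofReal (show 0 ≤ 1 - 2 * q by linarith)]

/-- Symmetry kills the odd moments. For `n ≥ 1` the even moment is `2 * q * r ^ (2 * n) ≤ 2 * q * r
^ t ≤ 1`, since `r ≥ 1`. -/
theorem hasSymmGaussianMoments_threePoint {t : ℕ} (hq : 0 ≤ q) (hq' : 2 * q ≤ 1) (hr : 1 ≤ r)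
    (hrt : 2 * q * r ^ t ≤ 1) :
    HasSymmGaussianMoments t 1 (fun x => x - 0) (threePoint q r) where
  integrable_pow n := integrable_threePoint _
  odd n hn := by
    rw [integral_threePoint hq hq']
    simp [hn.neg_pow, hn.pos.ne']
  even n hn := by
    rw [integral_threePoint hq hq', one_pow, mul_one]
    have h1 : (1 : ℝ) ≤ ((2 * n - 1)‼ : ℕ) := by
      exact_mod_cast Nat.doubleFactorial_pos _
    refine le_trans ?_ h1
    rcases Nat.eq_zero_or_pos n with rfl | hn0
    · simp; linarith
    · have h2 := mul_le_mul_of_nonneg_left (pow_le_pow_right₀ hr hn) (by positivity : 0 ≤ 2 * q)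
      simp only [sub_zero, (even_two_mul n).neg_pow]
      rw [zero_pow (by omega)]
      linarith

theorem dirac_le_threePoint (hq : 0 < q) (b : Bool) :
    Measure.dirac (if b then r else -r) ≤ (q⁻¹).toNNReal • threePoint q r := by
  have h1 : ((q⁻¹).toNNReal : ENNReal) * ENNReal.ofReal q = 1 := by
    change ENNReal.ofReal q⁻¹ * ENNReal.ofReal q = 1
    rw [← ENNReal.ofReal_mul (by positivity), inv_mul_cancel₀ hq.ne', ENNReal.ofReal_one]
  refine Measure.le_iff.2 fun s _ => ?_
  simp only [threePoint, Measure.smul_apply, Measure.add_apply, ENNReal.smul_def, smul_eq_mul,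
    mul_add, ← mul_assoc, h1, one_mul]
  cases b
  · simp only [Bool.false_eq_true, if_false, add_assoc]
    exact le_self_add
  · simp only [if_true]
    exact le_add_right le_add_self

/-- Only one coordinate differs from the reference product, so the factor is `q⁻¹` whatever the
dimension. -/
theorem pi_dirac_threePoint_le {d : ℕ} (hq : 0 < q) (hq' : 2 * q ≤ 1) (i₀ : Fin d) (b : Bool) :
    (Measure.pi fun i => if i = i₀ then Measure.dirac (if b then r else -r) else threePoint q r)
      ≤ (q⁻¹).toNNReal • Measure.pi fun _ : Fin d => threePoint q r := by
  have hκ := isProbabilityMeasure_threePoint (r := r) hq.le hq'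
  have hν : ∀ i : Fin d, IsFiniteMeasure
      (if i = i₀ then Measure.dirac (if b then r else -r) else threePoint q r) := fun i => by
    by_cases h : i = i₀
    · rw [if_pos h]; infer_instance
    · rw [if_neg h]; infer_instance
  let c : Fin d → NNReal := fun i => if i = i₀ then (q⁻¹).toNNReal else 1
  have hc : ∏ i, c i = (q⁻¹).toNNReal := by simp [c]
  rw [← hc]
  refine pi_le_smul_pi c fun i => ?_
  by_cases h : i = i₀
  · simp only [c, if_pos h]
    exact dirac_le_threePoint hq b
  · simp only [c, if_neg h, one_smul]
    exact le_rfl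

end threePoint

theorem hasSubGaussianMoments_dirac {d : ℕ} (t : ℕ) (x : Rd d) :
    HasSubGaussianMoments t x (Measure.dirac x) where
  prob := inferInstance
  integrable := integrable_dirac (by simp)
  mean := by simp
  integrable_pow s _ _ v _ := integrable_dirac (by simp)
  moment_le s _ _ v _ := by
    rw [integral_dirac, sub_self, inner_zero_left]
    -- At `s = 0` the left side is `0 ^ 0 = 1`, and truncated subtraction makes the right side `0‼ =
    -- 1`.
    exact (pow_le_one₀ le_rfl zero_le_one).trans (by exact_mod_cast Nat.doubleFactorial_pos _)

theorem ncard_le_one_of_separated {d : ℕ} {ι : Type*} (ν : ι → Rd d) {r b : ℝ} (hb : 2 * b < r)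
    (hν : ∀ j j', j ≠ j' → r ≤ ‖ν j - ν j'‖) (y : Rd d) : {j | ‖y - ν j‖ ≤ b}.ncard ≤ 1 := by
  have h : {j | ‖y - ν j‖ ≤ b}.Subsingleton := by
    intro j hj j' hj'
    by_contra hne
    have h1 := hν j j' hne
    have h2 : ‖ν j - ν j'‖ ≤ ‖y - ν j'‖ + ‖y - ν j‖ := by
      rw [show ν j - ν j' = (y - ν j') - (y - ν j) by abel]
      exact norm_sub_le _ _
    simp only [Set.mem_ofPred_eq] at hj hj'
    linarith
  exact (Set.ncard_le_one h.finite).2 fun a ha b hb => h ha hb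

/-! ### Relative weights and the sub-Gaussian bound -/

section relWeight

variable {k : ℕ} {w : Fin k → ℝ} {ε wlow : ℝ}

/-- Since `wlow ^ 2 ≤ wlow ≤ w s ≤ (w s + ε) / 2`, the term `wlow ^ 2` costs at most a factor `3 /
2`. -/
theorem one_div_relWeight_le (hw : IsMixingWeights w ε wlow) (s : Fin k) (hs : w s ≤ ε) :
    1 / relWeight (w s) ε wlow ≤ 3 / (2 * (w s / (w s + ε))) := by
  have h0 := hw.wlow_pos
  have h1 := hw.wlow_le s
  have h2 := hw.eps_pos
  have h3 : w s ≤ ∑ i, w i :=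
    Finset.single_le_sum (fun i _ => (h0.trans_le (hw.wlow_le i)).le) (Finset.mem_univ s)
  have h4 := hw.sum_eq_one
  have h5 : 0 < w s := h0.trans_le h1
  rw [relWeight, one_div_div, show 3 / (2 * (w s / (w s + ε))) = (3 * (w s + ε) / 2) / w s by
    field_simp]
  refine div_le_div_of_nonneg_right ?_ h5.le
  nlinarith

theorem two_le_one_div_relWeight (hw : IsMixingWeights w ε wlow) (s : Fin k) (hs : w s ≤ ε) :
    2 ≤ 1 / relWeight (w s) ε wlow := by
  have h5 : 0 < w s := hw.wlow_pos.trans_le (hw.wlow_le s)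
  rw [relWeight, one_div_div, le_div_iff₀ h5]
  nlinarith [sq_nonneg wlow]

end relWeight

theorem subGaussian_lower_bound {t : ℕ} (ht : 0 < t) {d k : ℕ} (hd : 1 ≤ d)
    {w : Fin k → ℝ} {ε wlow Δ : ℝ} (hw : IsMixingWeights w ε wlow) (s : Fin k) (hs : w s ≤ ε)
    {A : Kernel (ℕ → Rd d) (HypothesisList d)} [IsMarkovKernel A] {β : Fin k → ℝ} {ℓ : ℕ}
    (hA : SolvesMixtureLearning A (HasSubGaussianMoments t) Δ w ε β ℓ)
    (hβ : β s < 1 / 6 * (1 / relWeight (w s) ε wlow) ^ (1 / (t : ℝ))) : k + d - 1 ≤ ℓ := by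
  have hws : 0 < w s := hw.wlow_pos.trans_le (hw.wlow_le s)
  have hε := hw.eps_pos
  set q : ℝ := w s / (w s + ε) with hqdef
  have hq : 0 < q := by positivity
  have hq' : 2 * q ≤ 1 := by
    rw [hqdef, mul_div_assoc', div_le_one (by positivity)]
    linarith
  have ht' : (1 : ℝ) ≤ t := by exact_mod_cast ht
  -- The largest `r` that the `t`-th moment permits: `2 * q * r ^ t = 1`.
  set r : ℝ := (1 / (2 * q)) ^ (1 / (t : ℝ)) with hrdef
  have hq2 : 1 ≤ 1 / (2 * q) := by rwa [one_le_div (by positivity)]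
  have hr : 1 ≤ r := Real.one_le_rpow hq2 (by positivity)
  have hrt : 2 * q * r ^ t = 1 := by
    rw [hrdef, one_div (t : ℝ), Real.rpow_inv_natCast_pow (by positivity) ht.ne']
    field_simp
  have hβr : 2 * β s < r := by
    have h1 := one_div_relWeight_le hw s hs
    have h2 := two_le_one_div_relWeight hw s hs
    -- The loss `3 ^ (1 / t) ≤ 3`, together with the requirement `2 * β s < r`, gives the constant
    -- `1 / 6`.
    have h3 : (1 / relWeight (w s) ε wlow) ^ (1 / (t : ℝ)) ≤ 3 * r := by
      calc _ ≤ (3 * (1 / (2 * q))) ^ (1 / (t : ℝ)) :=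
            Real.rpow_le_rpow (by linarith) (h1.trans (le_of_eq (by ring))) (by positivity)
        _ = 3 ^ (1 / (t : ℝ)) * r := Real.mul_rpow (by norm_num) (by positivity)
        _ ≤ 3 ^ (1 : ℝ) * r := by
          gcongr
          · norm_num
          · exact (div_le_one (by positivity)).2 ht'
        _ = _ := by rw [Real.rpow_one]
    linarith
  have : Nonempty (Fin d) := ⟨⟨0, hd⟩⟩
  have hκ := isProbabilityMeasure_threePoint (r := r) hq.le hq'
  let m : Fin d × Bool → Fin d → ℝ := fun j => Pi.single j.1 (if j.2 then r else -r)
  let κ : Fin d × Bool → Fin d → Measure ℝ := fun j i =>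
    if i = j.1 then Measure.dirac (if j.2 then r else -r) else threePoint q r
  have hκp : ∀ j i, IsProbabilityMeasure (κ j i) := fun j i => by
    simp only [κ]; split_ifs <;> infer_instance
  have htoLp : Measurable (WithLp.toLp 2 : (Fin d → ℝ) → Rd d) := by fun_prop
  have hR : IsProbabilityMeasure ((Measure.pi fun _ => threePoint q r).map
      (WithLp.toLp 2 : (Fin d → ℝ) → Rd d)) := Measure.isProbabilityMeasure_map htoLp.aemeasurable
  have hP : ∀ j, IsProbabilityMeasure ((Measure.pi (κ j)).map
      (WithLp.toLp 2 : (Fin d → ℝ) → Rd d)) := fun j =>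
    Measure.isProbabilityMeasure_map htoLp.aemeasurable
  have hmem : ∀ j, HasSubGaussianMoments t (WithLp.toLp 2 (m j))
      ((Measure.pi (κ j)).map (WithLp.toLp 2 : (Fin d → ℝ) → Rd d)) := fun j => by
    refine hasSubGaussianMoments_map_pi (κ j) (m j) fun i => ?_
    by_cases h : i = j.1
    · subst h
      simp only [κ, m, if_true, Pi.single_eq_same]
      refine ⟨fun n => integrable_dirac (by simp), fun n hn => ?_, fun n hn => ?_⟩
      · rw [integral_dirac, sub_self, zero_pow hn.pos.ne']
      · rw [integral_dirac, sub_self, one_pow, mul_one]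
        exact (pow_le_one₀ le_rfl zero_le_one).trans (by exact_mod_cast Nat.doubleFactorial_pos _)
    · simp only [κ, m, h, if_false, Pi.single_eq_of_ne h]
      exact hasSymmGaussianMoments_threePoint hq.le hq' hr hrt.le
  have hpi : ∀ j, Measure.pi (κ j)
      ≤ (q⁻¹).toNNReal • Measure.pi fun _ : Fin d => threePoint q r := fun j =>
    pi_dirac_threePoint_le hq hq' j.1 j.2
  have hle : ∀ j, ENNReal.ofReal (w s) • (Measure.pi (κ j)).map
        (WithLp.toLp 2 : (Fin d → ℝ) → Rd d)
      ≤ ENNReal.ofReal (w s + ε) • (Measure.pi fun _ => threePoint q r).map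
        (WithLp.toLp 2 : (Fin d → ℝ) → Rd d) := fun j => by
    refine ofReal_smul_map_le_ofReal_smul_map htoLp (hpi j) hws.le (le_of_eq ?_)
    rw [hqdef]
    field_simp
  have hsep : ∀ j j', j ≠ j' → r ≤ ‖(WithLp.toLp 2 (m j) : Rd d) - WithLp.toLp 2 (m j')‖ := by
    intro j j' hjj
    refine le_trans ?_ (PiLp.norm_apply_le _ j.1)
    obtain ⟨i, b⟩ := j
    obtain ⟨i', b'⟩ := j'
    by_cases h : i = i'
    · subst h
      have h2 : r ≤ |r + r| := by rw [abs_of_nonneg (by linarith)]; linarith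
      have h3 : r ≤ |-r - r| := by rw [← abs_neg, neg_sub, sub_neg_eq_add]; exact h2
      cases b <;> cases b' <;> simp [m] at hjj ⊢ <;> assumption
    · cases b <;> simp [m, h, abs_of_pos (zero_lt_one.trans_le hr)]
  obtain ⟨n, hn1, hn2⟩ := exists_card_le_of_solves hd hw s hA
    (fun x => ⟨Measure.dirac x, inferInstance, hasSubGaussianMoments_dirac t x⟩)
    (fun j => (WithLp.toLp 2 (m j) : Rd d)) _ hmem _ hle 1
    (ncard_le_one_of_separated _ hβr hsep)
  simp at hn2
  omega

/-! ### Domination of shifted Gaussians -/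

theorem multivariateGaussian_one_eq_map_pi {d : ℕ} (μ : Rd d) :
    multivariateGaussian μ 1 = (Measure.pi fun i => gaussianReal (μ i) 1).map
      (WithLp.toLp 2 : (Fin d → ℝ) → Rd d) := by
  have h1 : (Measure.pi fun i => gaussianReal (μ i) 1)
      = (Measure.pi fun _ : Fin d => gaussianReal 0 1).map fun x i => μ i + x i := by
    rw [Measure.pi_map_pi (f := fun i x => μ i + x)
      (fun i => (measurable_const_add (μ i)).aemeasurable)]
    simp [gaussianReal_map_const_add]
  rw [h1, multivariateGaussian, ← map_pi_eq_stdGaussian, Measure.map_map, Measure.map_map]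
  · congr 1
    ext x i
    simp
  all_goals fun_prop

/-- Inflating the variance by `a` absorbs any shift up to `a`. The normalisation costs `√(1 + a) ≤
exp (a / 2)`, and the exponents differ by at most `a / 2` because `2 * z * x ≤ a * (z ^ 2 + 1)` with
`z = y - x`. -/
theorem gaussianPDFReal_le_exp_mul {x : ℝ} {a : NNReal} (hx : |x| ≤ a) (y : ℝ) :
    gaussianPDFReal x 1 y ≤ Real.exp a * gaussianPDFReal 0 (1 + a) y := by
  have ha : (0 : ℝ) ≤ a := a.2
  simp only [gaussianPDFReal, NNReal.coe_one, NNReal.coe_add, mul_one, sub_zero]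
  rw [Real.sqrt_mul (by positivity) (1 + (a : ℝ)), mul_inv]
  have h1 : √(1 + (a : ℝ)) ≤ Real.exp (a / 2) := by
    rw [Real.sqrt_le_left (by positivity), ← Real.exp_nat_mul]
    have := Real.add_one_le_exp (a : ℝ)
    push_cast
    rw [mul_div_cancel₀ _ (two_ne_zero' ℝ)]
    linarith
  have h2 : y ^ 2 / (2 * (1 + a)) ≤ (y - x) ^ 2 / 2 + a / 2 := by
    rw [div_le_iff₀ (by positivity)]
    have h3 : 2 * ((y - x) * x) ≤ a * ((y - x) ^ 2 + 1) := by
      have h4 : (y - x) * x ≤ |y - x| * a :=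
        (le_abs_self _).trans (by rw [abs_mul]; gcongr)
      nlinarith [mul_nonneg ha (sq_nonneg (|y - x| - 1)), sq_abs (y - x)]
    have h5 : x ^ 2 ≤ (a : ℝ) ^ 2 := sq_le_sq' (by linarith [neg_abs_le x]) ((le_abs_self x).trans hx)
    nlinarith
  have h3 : Real.exp (-(y - x) ^ 2 / 2) * √(1 + (a : ℝ))
      ≤ Real.exp a * Real.exp (-y ^ 2 / (2 * (1 + a))) := by
    calc _ ≤ Real.exp (-(y - x) ^ 2 / 2) * Real.exp (a / 2) := by gcongr
      _ ≤ _ := by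
        rw [← Real.exp_add, ← Real.exp_add, Real.exp_le_exp, neg_div, neg_div]
        linarith
  have h4 : 0 < √(1 + (a : ℝ)) := Real.sqrt_pos.2 (by positivity)
  calc (√(2 * Real.pi))⁻¹ * Real.exp (-(y - x) ^ 2 / 2)
      = (√(2 * Real.pi))⁻¹ * (√(1 + (a : ℝ)))⁻¹ * (Real.exp (-(y - x) ^ 2 / 2) * √(1 + (a : ℝ))) := by
        field_simp
    _ ≤ (√(2 * Real.pi))⁻¹ * (√(1 + (a : ℝ)))⁻¹
          * (Real.exp a * Real.exp (-y ^ 2 / (2 * (1 + a)))) := by gcongr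
    _ = _ := by ring

theorem gaussianReal_le_smul {x : ℝ} {a : NNReal} (hx : |x| ≤ a) :
    gaussianReal x 1 ≤ (Real.exp a).toNNReal • gaussianReal 0 (1 + a) := by
  rw [gaussianReal_of_var_ne_zero _ one_ne_zero, gaussianReal_of_var_ne_zero _ (by positivity)]
  change _ ≤ ((Real.exp a).toNNReal : ENNReal) • volume.withDensity _
  rw [← withDensity_smul _ (measurable_gaussianPDF _ _)]
  refine withDensity_mono (Filter.Eventually.of_forall fun y => ?_)
  change ENNReal.ofReal _ ≤ ENNReal.ofReal _ * ENNReal.ofReal _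
  rw [← ENNReal.ofReal_mul (Real.exp_pos _).le]
  exact ENNReal.ofReal_le_ofReal (gaussianPDFReal_le_exp_mul hx y)

theorem pi_gaussianReal_le_smul {d : ℕ} {μ : Fin d → ℝ} {a : Fin d → NNReal}
    (h : ∀ i, |μ i| ≤ a i) :
    (Measure.pi fun i => gaussianReal (μ i) 1)
      ≤ (Real.exp (∑ i, (a i : ℝ))).toNNReal • Measure.pi fun i => gaussianReal 0 (1 + a i) := by
  have := pi_le_smul_pi (fun i => (Real.exp (a i)).toNNReal) fun i => gaussianReal_le_smul (h i)
  rwa [← Real.toNNReal_prod_of_nonneg fun i _ => (Real.exp_pos _).le, ← Real.exp_sum] at this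

/-! ### Grid points in a ball -/

/-- A set of words of length `m` over an alphabet of size `256`, any two of which agree in at least
half of the positions, has at most `32 ^ m` elements. -/
theorem ncard_le_of_two_mul_hammingDist_le {m : ℕ} (S : Set (Fin m → Fin 256))
    (hS : ∀ u ∈ S, ∀ u' ∈ S, 2 * hammingDist u u' ≤ m) : S.ncard ≤ 32 ^ m := by
  classical
  rcases S.eq_empty_or_nonempty with rfl | ⟨u₀, hu₀⟩
  · simp
  -- Weight each word by `256` to the number of its agreements with `u₀`. The total is `(256 + 255)
  -- ^ m`, and each member of `S` weighs at least `256 ^ (m / 2) = 16 ^ m`.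
  have h1 : ∑ u : Fin m → Fin 256, ∏ i, (if u₀ i = u i then 256 else 1) ≤ 512 ^ m := by
    rw [← Fintype.piFinset_univ, ← Finset.prod_univ_sum (fun _ => Finset.univ)
      (fun i c => if u₀ i = c then 256 else 1)]
    refine (Finset.prod_le_pow_card _ _ 512 fun i _ => ?_).trans (by simp)
    rw [Finset.sum_ite]
    have := Finset.card_filter_le (Finset.univ : Finset (Fin 256)) fun c => ¬ u₀ i = c
    simp [Finset.filter_eq] at this ⊢
    omega
  have h2 : ∀ u ∈ S, 16 ^ m ≤ ∏ i, (if u₀ i = u i then 256 else 1) := fun u hu => by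
    rw [Finset.prod_ite]
    simp only [Finset.prod_const, one_pow, mul_one]
    have h3 := Finset.card_filter_add_card_filter_not (s := (Finset.univ : Finset (Fin m))) (fun i => u₀ i = u i)
    have h4 := hS u₀ hu₀ u hu
    rw [hammingDist] at h4
    simp only [Finset.card_univ, Fintype.card_fin] at h3
    refine le_trans ?_ (pow_mul 16 2 _).le
    exact Nat.pow_le_pow_right (by norm_num) (by simp only [ne_eq] at h4; omega)
  have h3 : S.ncard * 16 ^ m ≤ 512 ^ m := by
    rw [Set.ncard_eq_toFinset_card']
    calc S.toFinset.card * 16 ^ m = ∑ u ∈ S.toFinset, 16 ^ m := by simp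
      _ ≤ ∑ u ∈ S.toFinset, ∏ i, (if u₀ i = u i then 256 else 1) :=
        Finset.sum_le_sum fun u hu => h2 u (by simpa using hu)
      _ ≤ _ := (Finset.sum_le_univ_sum_of_nonneg fun _ => Nat.zero_le _).trans h1
  rw [show 512 = 32 * 16 by norm_num, mul_pow] at h3
  exact Nat.le_of_mul_le_mul_right h3 (by positivity)

/-- The point of the grid `δ • {0, …, 255} ^ m` in `ℝ ^ (m + e)` with label `u`. -/
noncomputable def gridPoint {m : ℕ} (e : ℕ) (δ : ℝ) (u : Fin m → Fin 256) : Rd (m + e) :=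
  WithLp.toLp 2 (Fin.append (fun i => δ * (u i : ℕ)) fun _ => 0)

theorem hammingDist_le_norm_gridPoint_sub {m : ℕ} (e : ℕ) (δ : ℝ) (u u' : Fin m → Fin 256) :
    δ ^ 2 * hammingDist u u' ≤ ‖gridPoint e δ u - gridPoint e δ u'‖ ^ 2 := by
  rw [EuclideanSpace.real_norm_sq_eq, Fin.sum_univ_add]
  simp only [gridPoint, PiLp.sub_apply, Fin.append_left, Fin.append_right, sub_self]
  rw [hammingDist, Finset.card_filter, Nat.cast_sum, Finset.mul_sum]
  refine le_add_of_le_of_nonneg (Finset.sum_le_sum fun i _ => ?_) (by simp)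
  split_ifs with h
  · rw [← mul_sub, mul_pow]
    refine mul_le_mul_of_nonneg_left ?_ (sq_nonneg δ)
    have h1 : ((u i : ℕ) : ℤ) - ((u' i : ℕ) : ℤ) ≠ 0 := fun h0 => h (Fin.ext (by omega))
    have h2 : 1 ≤ (((u i : ℕ) : ℤ) - ((u' i : ℕ) : ℤ)) ^ 2 := by
      have := sq_pos_of_ne_zero h1
      omega
    exact_mod_cast h2
  · simpa using sq_nonneg _

/-- Two grid points in one ball are at distance at most `2 * b`, so their labels satisfy `δ ^ 2 *
hammingDist ≤ 4 * b ^ 2 ≤ δ ^ 2 * m / 2`. -/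
theorem ncard_gridPoint_le {m : ℕ} (e : ℕ) {δ b b' : ℝ} (hδ : 0 < δ) (hb : 8 * b ^ 2 ≤ δ ^ 2 * m)
    (hb' : b' ≤ b) (y : Rd (m + e)) :
    {u : Fin m → Fin 256 | ‖y - gridPoint e δ u‖ ≤ b'}.ncard ≤ 32 ^ m := by
  refine ncard_le_of_two_mul_hammingDist_le _ fun u hu u' hu' => ?_
  simp only [Set.mem_ofPred_eq] at hu hu'
  have h1 : ‖gridPoint e δ u - gridPoint e δ u'‖ ≤ 2 * b := by
    rw [show gridPoint e δ u - gridPoint e δ u'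
      = (y - gridPoint e δ u') - (y - gridPoint e δ u) by abel]
    exact (norm_sub_le _ _).trans (by linarith)
  have h2 := pow_le_pow_left₀ (norm_nonneg _) h1 2
  have h3 := hammingDist_le_norm_gridPoint_sub e δ u u'
  have h4 : δ ^ 2 * (2 * hammingDist u u' : ℝ) ≤ δ ^ 2 * m := by nlinarith
  exact_mod_cast le_of_mul_le_mul_left h4 (by positivity)

/-! ### The Gaussian bound -/

theorem gaussian_grid_lower_bound {m e k : ℕ} (hd : 1 ≤ m + e)
    {w : Fin k → ℝ} {ε wlow Δ δ b : ℝ} (hw : IsMixingWeights w ε wlow) (s : Fin k)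
    {A : Kernel (ℕ → Rd (m + e)) (HypothesisList (m + e))} [IsMarkovKernel A] {β : Fin k → ℝ}
    {ℓ : ℕ} (hA : SolvesMixtureLearning A IsSphericalGaussian Δ w ε β ℓ)
    (hδ : 0 < δ) (hb : 8 * b ^ 2 ≤ δ ^ 2 * m) (hβ : β s ≤ b)
    (hexp : w s * Real.exp (m * (256 * δ)) ≤ w s + ε) :
    ∃ n : ℕ, n + k ≤ ℓ + 1 ∧ 8 ^ m ≤ 2 * n := by
  have hws : 0 < w s := hw.wlow_pos.trans_le (hw.wlow_le s)
  have htoLp : Measurable (WithLp.toLp 2 : (Fin (m + e) → ℝ) → Rd (m + e)) := by fun_prop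
  -- Only the `m` grid coordinates need inflation; the other `e` contribute nothing to the exponent.
  let a : Fin (m + e) → NNReal := Fin.append (fun _ => (256 * δ).toNNReal) fun _ => 0
  have hsum : ∑ i, (a i : ℝ) = m * (256 * δ) := by
    rw [Fin.sum_univ_add]
    simp [a, hδ.le]
  have ha : ∀ u i, |gridPoint e δ u i| ≤ a i := fun u i => by
    refine Fin.addCases (fun i => ?_) (fun i => ?_) i
    · have h1 : ((u i : ℕ) : ℝ) ≤ 256 := by exact_mod_cast (u i).2.le
      simp only [gridPoint, a, Fin.append_left, Real.coe_toNNReal _ (by positivity : 0 ≤ 256 * δ)]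
      rw [abs_of_nonneg (by positivity)]
      nlinarith
    · simp [gridPoint, a]
  have hR : IsProbabilityMeasure ((Measure.pi fun i => gaussianReal 0 (1 + a i)).map
      (WithLp.toLp 2 : (Fin (m + e) → ℝ) → Rd (m + e))) :=
    Measure.isProbabilityMeasure_map htoLp.aemeasurable
  obtain ⟨n, hn1, hn2⟩ := exists_card_le_of_solves hd hw s hA
    (fun x => ⟨multivariateGaussian x 1, inferInstance, rfl⟩)
    (gridPoint e δ) (fun u => multivariateGaussian (gridPoint e δ u) 1) (fun _ => rfl)
    ((Measure.pi fun i => gaussianReal 0 (1 + a i)).map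
      (WithLp.toLp 2 : (Fin (m + e) → ℝ) → Rd (m + e)))
    (fun u => by
      rw [multivariateGaussian_one_eq_map_pi]
      exact ofReal_smul_map_le_ofReal_smul_map htoLp (pi_gaussianReal_le_smul (ha u)) hws.le
        (by rwa [hsum]))
    (32 ^ m) (ncard_gridPoint_le e hδ hb hβ)
  refine ⟨n, hn1, ?_⟩
  simp only [Fintype.card_pi, Fintype.card_fin, Finset.prod_const, Finset.card_univ] at hn2
  rw [show 256 = 32 * 8 by norm_num, mul_pow, mul_left_comm] at hn2
  exact Nat.le_of_mul_le_mul_left hn2 (by positivity)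

theorem gaussian_lower_bound {p : ℝ} (hp : 0 < p) {d k : ℕ} (hd : 1 ≤ d)
    {w : Fin k → ℝ} {ε wlow Δ : ℝ} (hw : IsMixingWeights w ε wlow) (s : Fin k) (hs : w s ≤ ε)
    {A : Kernel (ℕ → Rd d) (HypothesisList d)} [IsMarkovKernel A] {β : Fin k → ℝ} {ℓ : ℕ}
    (hA : SolvesMixtureLearning A IsSphericalGaussian Δ w ε β ℓ)
    (hβ : β s < 1 / (2048 * √(p + 1)) * √(Real.log (1 / relWeight (w s) ε wlow))) :
    (k : ℝ) + min ((2 : ℝ) ^ (d : ℝ)) ((1 / relWeight (w s) ε wlow) ^ p) ≤ ℓ := by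
  have hws : 0 < w s := hw.wlow_pos.trans_le (hw.wlow_le s)
  have hε := hw.eps_pos
  set ρ := 1 / relWeight (w s) ε wlow with hρ
  have hρ2 : 2 ≤ ρ := two_le_one_div_relWeight hw s hs
  have hρle := one_div_relWeight_le hw s hs
  set Λ := Real.log ρ with hΛ
  have hl2 : 1 / 2 < Real.log 2 := by linarith [Real.log_two_gt_d9]
  have hΛ2 : Real.log 2 ≤ Λ := Real.log_le_log (by norm_num) hρ2
  have hΛ0 : 0 < Λ := by linarith
  -- With `z = (w s + ε) / w s ≥ 2`, one has `ρ ≤ 3 / 2 * z ≤ z ^ 2`; halving `Λ` thus absorbs the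
  -- constant.
  have hexpΛ : w s * Real.exp (Λ / 2) ≤ w s + ε := by
    have h1 : ρ ≤ ((w s + ε) / w s) ^ 2 := by
      have h2 : 2 ≤ (w s + ε) / w s := by
        rw [le_div_iff₀ hws]; linarith
      have h3 : 3 / (2 * (w s / (w s + ε))) = 3 / 2 * ((w s + ε) / w s) := by
        field_simp
      nlinarith
    have h2 : Real.exp (Λ / 2) ≤ (w s + ε) / w s := by
      refine (sq_le_sq₀ (by positivity) (by positivity)).1 ?_
      rw [← Real.exp_nat_mul]
      push_cast
      rwa [mul_div_cancel₀ _ (two_ne_zero' ℝ), hΛ, Real.exp_log (by linarith)]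
    rw [le_div_iff₀ hws] at h2
    linarith
  -- Large enough that `2 ^ m` reaches the target minimum, yet of order at most `(p + 1) * Λ`.
  set m := min d ⌈p * Λ / Real.log 2⌉₊ with hm
  have hm1 : 1 ≤ m := le_min hd (Nat.one_le_ceil_iff.2 (by positivity))
  have hm0 : (0 : ℝ) < m := by exact_mod_cast hm1
  have hmle : (m : ℝ) ≤ 2 * (p + 1) * Λ := by
    have h1 : (m : ℝ) ≤ ⌈p * Λ / Real.log 2⌉₊ := by exact_mod_cast min_le_right _ _
    have h2 := Nat.ceil_lt_add_one (show 0 ≤ p * Λ / Real.log 2 by positivity)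
    have h3 : p * Λ / Real.log 2 ≤ 2 * (p * Λ) := by
      rw [div_le_iff₀ (by positivity)]
      nlinarith [mul_pos hp hΛ0]
    linarith
  have hmin : min ((2 : ℝ) ^ (d : ℝ)) (ρ ^ p) ≤ 2 ^ m := by
    rcases min_choice d ⌈p * Λ / Real.log 2⌉₊ with h | h
    · refine (min_le_left _ _).trans ?_
      rw [hm, h, Real.rpow_natCast]
    · refine (min_le_right _ _).trans ?_
      rw [hm, h, ← Real.rpow_natCast, Real.rpow_def_of_pos (by linarith), Real.rpow_def_of_pos two_pos,
        Real.exp_le_exp]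
      have := Nat.le_ceil (p * Λ / Real.log 2)
      rw [div_le_iff₀ (by positivity)] at this
      linarith
  -- This spends the whole budget: `256 * m * δ = Λ / 2`. With `m ≤ 2 * (p + 1) * Λ` the ball
  -- condition then holds with constant exactly `1 / (2048 * √(p + 1))`.
  set δ : ℝ := Λ / (512 * m) with hδ
  have hδ0 : 0 < δ := by positivity
  obtain ⟨e, he⟩ := Nat.exists_eq_add_of_le (min_le_left d ⌈p * Λ / Real.log 2⌉₊)
  rw [← hm] at he
  clear_value m
  subst he
  obtain ⟨n, hn1, hn2⟩ := gaussian_grid_lower_bound hd hw s hA hδ0 (by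
    rw [mul_pow, Real.sq_sqrt hΛ0.le, div_pow, mul_pow, Real.sq_sqrt (by positivity), one_pow]
    have h2 : δ ^ 2 * m = Λ * (Λ / m) / 512 ^ 2 := by
      rw [hδ]; field_simp
    have h3 : 1 / (2 * (p + 1)) ≤ Λ / m := by
      rw [div_le_div_iff₀ (by positivity) hm0]
      linarith
    rw [h2]
    have h4 := mul_le_mul_of_nonneg_left h3 hΛ0.le
    have h5 : 1 / (2048 ^ 2 * (p + 1)) * Λ = (Λ * (1 / (2 * (p + 1)))) * (2 / 2048 ^ 2) := by
      field_simp
    rw [h5]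
    have h6 : 0 ≤ Λ * (1 / (2 * (p + 1))) := by positivity
    linarith) hβ.le (by
    rwa [show (m : ℝ) * (256 * δ) = Λ / 2 by rw [hδ]; field_simp; norm_num])
  have h1 : (n : ℝ) + k ≤ ℓ + 1 := by exact_mod_cast hn1
  -- As `m ≥ 1`, `8 ^ m ≥ 4 * 2 ^ m` and so `n ≥ 2 * 2 ^ m`. The spare `1` compensates for only `k -
  -- 1` entries being forced by the other components.
  have h2 : (2 : ℝ) ^ m + 1 ≤ n := by
    have h3 : 2 ^ m * 4 ≤ 8 ^ m := by
      rw [show 8 = 2 * 4 by norm_num, mul_pow]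
      exact Nat.mul_le_mul_left _ (Nat.le_self_pow (by omega) 4)
    have h4 : 1 ≤ 2 ^ m := Nat.one_le_two_pow
    exact_mod_cast (by omega : 2 ^ m + 1 ≤ n)
  linarith

theorem proposition1 :
    -- (a) inliers with sub-Gaussian `t`-th central moments
    (∃ c : ℝ, 0 < c ∧
      ∀ (t : ℕ), 0 < t → Even t →
      ∀ (K C : ℝ), 0 < K → 0 < C →
      ∀ (d k : ℕ), 1 ≤ d →
      ∀ (w : Fin k → ℝ) (ε wlow : ℝ), IsMixingWeights w ε wlow →
      ∀ (s : Fin k), w s ≤ ε →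
      ∀ (A : Kernel (ℕ → Rd d) (HypothesisList d)), IsMarkovKernel A →
      ∀ (β : Fin k → ℝ) (ℓ : ℕ), (∀ i, β i ≤ C * (1 / wlow) ^ (1 / (t : ℝ))) →
        SolvesMixtureLearning A (HasSubGaussianMoments t) (K * (1 / wlow) ^ (4 / (t : ℝ)))
          w ε β ℓ →
        c * (1 / relWeight (w s) ε wlow) ^ (1 / (t : ℝ)) ≤ β s ∨ k + d - 1 ≤ ℓ) ∧
    -- (b) Gaussian inliers
    (∃ a : ℝ, 0 < a ∧ ∀ p : ℝ, 0 < p → ∃ c : ℝ, 0 < c ∧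
      ∀ (K C : ℝ), 0 < K → 0 < C →
      ∀ (d k : ℕ), 1 ≤ d →
      ∀ (w : Fin k → ℝ) (ε wlow : ℝ), IsMixingWeights w ε wlow →
      ∀ (s : Fin k), w s ≤ ε →
      ∀ (A : Kernel (ℕ → Rd d) (HypothesisList d)), IsMarkovKernel A →
      ∀ (β : Fin k → ℝ) (ℓ : ℕ), (∀ i, β i ≤ C * √(Real.log (1 / wlow))) →
        SolvesMixtureLearning A IsSphericalGaussian (K * √(Real.log (1 / wlow))) w ε β ℓ →
        c * √(Real.log (1 / relWeight (w s) ε wlow)) ≤ β s ∨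
          (k : ℝ) + min ((2 : ℝ) ^ (a * (d : ℝ))) ((1 / relWeight (w s) ε wlow) ^ p)
            ≤ (ℓ : ℝ)) := by
  refine ⟨⟨1 / 6, by norm_num, ?_⟩, ⟨1, one_pos, fun p hp =>
    ⟨1 / (2048 * √(p + 1)), by positivity, ?_⟩⟩⟩
  · intro t ht _ K C _ _ d k hd w ε wlow hw s hs A _ β ℓ _ hA
    refine or_iff_not_imp_left.2 fun h => ?_
    exact subGaussian_lower_bound ht hd hw s hs hA (not_le.1 h)
  · intro K C _ _ d k hd w ε wlow hw s hs A _ β ℓ _ hA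
    refine or_iff_not_imp_left.2 fun h => ?_
    rw [one_mul]
    exact gaussian_lower_bound hp hd hw s hs hA (not_le.1 h)
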